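/- A directed metric on a set $X$ is a function $d\colon X\times X\to\mathbb{R}_+$ with $d(x,x)=0$ and $d(x,z)\le d(x,y)+d(y,z)$ for all $x,y,z\in X$ (symmetry is not assumed, and $d(x,y)=0$ is allowed for $x\ne y$). A network $(V,E,S,c)$ consists of a finite directed graph $(V,E)$ (loops and parallel edges allowed), a set $S\subseteq V$ of terminals, and a capacity function $c\colon E\to\mathbb{Z}_{\ge 0}$; an edge with tail $x$ and head $y$ is written $xy$. An $S$-path is a directed path in $(V,E)$, without repeated vertices, from a terminal $s_P$ to a different terminal $t_P$. A multiflow is a pair $f=(\mathcal{P},\lambda)$ of a set $\mathcal{P}$ of $S$-paths and a function $\lambda\colon\mathcal{P}\to\mathbb{R}_+$ with $\sum\{\lambda(P)\mid P\in\mathcal{P},\ P\text{ contains }e\}\le c(e)$ for every $e\in E$. For $\mu\colon S\times S\to\mathbb{R}_+$ its value is $\mathrm{val}(\mu,f)=\sum_{P\in\mathcal{P}}\mu(s_P,t_P)\lambda(P)$. Let $S^c=\{s^c\mid s\in S\}$ and $S^r=\{s^r\mid s\in S\}$ be disjoint copies of $S$, let $S^{cr}=S^c\cup S^r$, and write $p=(p^c,p^r)$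 for the restrictions of $p\in\mathbb{R}^{S^{cr}}$ to $S^c$ and $S^r$. The directed tight span $T_\mu$ is the set of minimal elements, in the coordinatewise order, of $$P_\mu=\{p\in\mathbb{R}_+^{S^{cr}}\mid p(s^c)+p(t^r)\ge\mu(s,t)\ \text{ for all } s,t\in S\}.$$ Put $D_\infty(p,q)=\max\{\|(q^c-p^c)_+\|_\infty,\ \|(p^r-q^r)_+\|_\infty\}$, where $(\cdot)_+$ is the coordinatewise positive part (and $\|\cdot\|_\infty=0$ on $\mathbb{R}^\emptyset$), and for $s\in S$ let $\mu_s\in\mathbb{R}^{S^{cr}}$ be given by $\mu_s(t^c)=\mu(t,s)$ and $\mu_s(t^r)=\mu(s,t)$ for $t\in S$. **Theorem.** Let $(V,E,S,c)$ be a network and let $\mu$ be a directed metric on $S$. Then $$\max\{\mathrm{val}(\mu,f)\mid f\text{ a multiflow in }(V,E,S,c)\}=\min\Big\{\sum_{xy\in E}c(xy)\,D_\infty(\rho(x),\rho(y))\ \Big|\ \rho\colon V\to T_\mu,\ \rho(s)=\mu_s\ (s\in S)\Big\},$$ where both the maximum and the minimum are attained. -/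

import Mathlib

noncomputable section

namespace DirectedTightSpan

/-- A directed metric on `X`: nonnegative, zero on the diagonal, satisfying the triangle
inequality. Neither symmetry nor positivity off the diagonal is required. -/
structure IsDirectedMetric {X : Type*} (d : X → X → ℝ) : Prop where
  nonneg : ∀ x y, 0 ≤ d x y
  self : ∀ x, d x x = 0
  triangle : ∀ x y z, d x z ≤ d x y + d y z

section TightSpan

variable {S : Type*}

/-- The polyhedron `P_μ` of nonnegative `p` with `p(s^c) + p(t^r) ≥ μ(s,t)`. In `S ⊕ S` the
element `Sum.inl s` is the copy `s^c` and `Sum.inr s` is the copy `s^r`. -/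
def polyhedron (μ : S → S → ℝ) : Set (S ⊕ S → ℝ) :=
  {p | (∀ s t, μ s t ≤ p (Sum.inl s) + p (Sum.inr t)) ∧ ∀ i, 0 ≤ p i}

/-- The directed tight span `T_μ`: the minimal points of `P_μ` in the coordinatewise order. -/
def tightSpan (μ : S → S → ℝ) : Set (S ⊕ S → ℝ) :=
  {p | Minimal (fun q => q ∈ polyhedron μ) p}

/-- The point `μ_s`, with `μ_s(t^c) = μ(t,s)` and `μ_s(t^r) = μ(s,t)`. -/
def terminalPoint (μ : S → S → ℝ) (s : S) : S ⊕ S → ℝ :=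
  Sum.elim (fun t => μ t s) (fun t => μ s t)

/-- `D_∞⁺(p,q) = ‖(q - p)₊‖_∞`; the norm on a finite power of `ℝ` is the sup norm. -/
def DInftyPlus {X : Type*} [Fintype X] (p q : X → ℝ) : ℝ :=
  ‖(q - p)⁺‖

/-- `D_∞(p,q) = max {D_∞⁺(p^c,q^c), D_∞⁺(q^r,p^r)}`. -/
def DInfty [Fintype S] (p q : S ⊕ S → ℝ) : ℝ :=
  max (DInftyPlus (p ∘ Sum.inl) (q ∘ Sum.inl)) (DInftyPlus (q ∘ Sum.inr) (p ∘ Sum.inr))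

end TightSpan

/-- A network: a directed graph with vertex set `V` and edge set `E` (each edge having a tail and
a head), a set `S` of terminals and a nonnegative integer capacity on every edge. -/
structure Network (V E : Type*) where
  tail : E → V
  head : E → V
  S : Finset V
  c : E → ℕ

namespace Network

variable {V E : Type*} (N : Network V E)

/-- The edges in the list `l` lead, consecutively, from `u` to `v`. -/
def IsWalk : V → List E → V → Prop
  | u, [], v => u = v
  | u, e :: l, v => N.tail e = u ∧ IsWalk (N.head e) l v

/-- An `S`-path: a directed path (no vertex repeated) connecting two distinct terminals. -/
structure SPath where
  source : V
  target : V
  edges : List E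
  source_mem : source ∈ N.S
  target_mem : target ∈ N.S
  source_ne_target : source ≠ target
  isWalk : N.IsWalk source edges target
  nodup_vertices : (source :: edges.map N.head).Nodup

open Classical in
/-- A multiflow `(𝒫, λ)`: a set of `S`-paths with nonnegative flow-values satisfying the capacity
constraint. Values of `flow` outside `paths` play no role. -/
structure Multiflow where
  paths : Finset N.SPath
  flow : N.SPath → ℝ
  flow_nonneg : ∀ P ∈ paths, 0 ≤ flow P
  capacity : ∀ e : E, ∑ P ∈ paths with e ∈ P.edges, flow P ≤ (N.c e : ℝ)

/-- The flow-value `val(μ,f) = ∑_{P ∈ 𝒫} μ(s_P,t_P) λ(P)`. -/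
def val (μ : N.S → N.S → ℝ) (f : N.Multiflow) : ℝ :=
  ∑ P ∈ f.paths, μ ⟨P.source, P.source_mem⟩ ⟨P.target, P.target_mem⟩ * f.flow P

end Network

end DirectedTightSpan

end

/-!
The multiflow problem is a packing linear program over the finitely many `S`-paths, so it has an
optimal solution together with an optimal dual solution: a length `l e ≥ 0` on every edge such that
every `S`-path `P` has length at least `μ(s_P, t_P)`, with `∑ c(e) l(e)` equal to the maximum
(`exists_packing_covering`). Strong duality is obtained by separating the convex cone of attainable
pairs (resource, profit) from the open set of pairs that use less than the available resources but
earn more than the optimum.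

Such lengths turn into a map to the tight span at no extra cost. Let `d` be the walk distance of `l`,
truncated at a large constant. The point `(d(·, x), d(x, ·))` lies in `P_μ`, and an edge `xy` moves it
by at most `l(xy)` in `D_∞`. The polyhedron `P_μ` retracts onto `T_μ` without increasing `D_∞`:
replace first `p^r`, then `p^c`, by the smallest vector that is feasible together with the other
half (`retraction_mem_tightSpan`, `DInfty_retraction_le`). The retraction never increases a coordinate,
which forces terminals to be sent to the points `μ_s` (`eq_terminalPoint`).

Conversely, for any admissible `ρ` the coordinate `x ↦ ρ(x)(s^c)` rises from `0` to `μ(s, t)` along a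
path from `s` to `t`, and along each edge by at most the `D_∞`-length of that edge; hence these lengths
are feasible for the dual program, and weak duality applies (`Network.val_le`).
-/

namespace DirectedTightSpan

/-! ### Duality for packing linear programs -/

section LinearProgramming

variable {J K : Type*} [Fintype K]

/-- A packing linear program all of whose variables are bounded by some constraint attains its
maximum. -/
theorem exists_packing_max (A : J → K → ℝ) (hA : ∀ j k, 0 ≤ A j k) (b : J → ℝ) (hb : ∀ j, 0 ≤ b j)
    (w : K → ℝ) (hcol : ∀ k, ∃ j, 0 < A j k) :
    ∃ x : K → ℝ, (∀ k, 0 ≤ x k) ∧ (∀ j, ∑ k, A j k * x k ≤ b j) ∧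
      ∀ z : K → ℝ, (∀ k, 0 ≤ z k) → (∀ j, ∑ k, A j k * z k ≤ b j) →
        ∑ k, w k * z k ≤ ∑ k, w k * x k := by
  choose i hi using hcol
  let F : Set (K → ℝ) := {x | (∀ k, 0 ≤ x k) ∧ ∀ j, ∑ k, A j k * x k ≤ b j}
  have hclosed : IsClosed F := by
    simp only [F, Set.ofPred_and, Set.ofPred_forall]
    refine (isClosed_iInter fun k => isClosed_le (by fun_prop) (by fun_prop)).inter
      (isClosed_iInter fun j => isClosed_le (by fun_prop) (by fun_prop))
  have hsub : F ⊆ Set.Icc 0 (fun k => b (i k) / A (i k) k) := by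
    rintro x ⟨hx, hxb⟩
    refine ⟨hx, fun k => ?_⟩
    rw [le_div_iff₀ (hi k), mul_comm]
    exact (Finset.single_le_sum (f := fun k' => A (i k) k' * x k')
      (fun k' _ => mul_nonneg (hA _ _) (hx k')) (Finset.mem_univ k)).trans (hxb (i k))
  have hcompact : IsCompact F := isCompact_Icc.of_isClosed_subset hclosed hsub
  obtain ⟨x, hx, hmax⟩ := hcompact.exists_isMaxOn ⟨0, by simpa [F] using hb⟩
    (f := fun x : K → ℝ => ∑ k, w k * x k) (by fun_prop)
  exact ⟨x, hx.1, hx.2, fun z hz hzb => hmax ⟨hz, hzb⟩⟩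

/-- An upper bound for a packing linear program with positive right-hand side is certified by a
feasible dual solution. Positivity of `b` is Slater's condition for the separation argument. -/
theorem exists_covering_of_forall_packing_le [Fintype J] (A : J → K → ℝ) (b : J → ℝ) (hb : ∀ j, 0 < b j)
    (w : K → ℝ) (m : ℝ)
    (hm : ∀ x : K → ℝ, (∀ k, 0 ≤ x k) → (∀ j, ∑ k, A j k * x k ≤ b j) → ∑ k, w k * x k ≤ m) :
    ∃ y : J → ℝ, (∀ j, 0 ≤ y j) ∧ (∀ k, w k ≤ ∑ j, A j k * y j) ∧ ∑ j, b j * y j ≤ m := by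
  classical
  let C : Set ((J → ℝ) × ℝ) := {a | ∃ x : K → ℝ, (∀ k, 0 ≤ x k) ∧
    (∀ j, ∑ k, A j k * x k ≤ a.1 j) ∧ a.2 ≤ ∑ k, w k * x k}
  let U : Set ((J → ℝ) × ℝ) := {a | (∀ j, a.1 j < b j) ∧ m < a.2}
  have hCadd : ∀ a ∈ C, ∀ a' ∈ C, a + a' ∈ C := by
    rintro a ⟨x, hx, hxa, hxw⟩ a' ⟨x', hx', hxa', hxw'⟩
    refine ⟨x + x', fun k => add_nonneg (hx k) (hx' k), fun j => ?_, ?_⟩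
    · simpa [mul_add, Finset.sum_add_distrib] using add_le_add (hxa j) (hxa' j)
    · simpa [mul_add, Finset.sum_add_distrib] using add_le_add hxw hxw'
  have hCsmul : ∀ a ∈ C, ∀ t : ℝ, 0 ≤ t → t • a ∈ C := by
    rintro a ⟨x, hx, hxa, hxw⟩ t ht
    refine ⟨t • x, fun k => mul_nonneg ht (hx k), fun j => ?_, ?_⟩
    · simpa [mul_left_comm, Finset.mul_sum] using mul_le_mul_of_nonneg_left (hxa j) ht
    · simpa [mul_left_comm, Finset.mul_sum] using mul_le_mul_of_nonneg_left hxw ht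
  have hCconv : Convex ℝ C := fun a ha a' ha' t t' ht ht' _ =>
    hCadd _ (hCsmul a ha t ht) _ (hCsmul a' ha' t' ht')
  have hUopen : IsOpen U := by
    simp only [U, Set.ofPred_and, Set.ofPred_forall]
    exact (isOpen_iInter_of_finite fun j => isOpen_lt (by fun_prop) (by fun_prop)).inter
      (isOpen_lt (by fun_prop) (by fun_prop))
  have hUconv : Convex ℝ U := by
    have : U = (Set.univ.pi fun j => Set.Iio (b j)) ×ˢ Set.Ioi m := by
      ext a; simp [U]
    rw [this]
    exact (convex_pi fun j _ => convex_Iio (b j)).prod (convex_Ioi m)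
  have hdisj : Disjoint U C := by
    rw [Set.disjoint_left]
    rintro a ⟨ha, ham⟩ ⟨x, hx, hxa, hxw⟩
    exact absurd (hm x hx fun j => (hxa j).trans (ha j).le) (not_le.2 (ham.trans_le hxw))
  obtain ⟨f, u, hfU, hfC⟩ := geometric_hahn_banach_open hUconv hUopen hCconv hdisj
  have hu : u ≤ 0 := by
    simpa using hfC 0 ⟨0, by simp, by simp, by simp⟩
  -- A functional bounded below on a cone is nonnegative there.
  have hfC0 : ∀ a ∈ C, 0 ≤ f a := by
    intro a ha
    by_contra! hneg
    have h := hfC _ (hCsmul a ha ((1 - u) / (-f a)) (div_nonneg (by linarith) (by linarith)))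
    rw [map_smul, smul_eq_mul, div_mul_eq_mul_div, le_div_iff₀ (by linarith)] at h
    nlinarith
  let φ : J → ℝ := fun j => f (Pi.single j 1, 0)
  let z : ℝ := f (0, 1)
  have hf : ∀ (y : J → ℝ) (r : ℝ), f (y, r) = ∑ j, y j * φ j + r * z := by
    intro y r
    have h : (y, r) = ∑ j, y j • ((Pi.single j 1, 0) : (J → ℝ) × ℝ) + r • ((0, 1) : (J → ℝ) × ℝ) := by
      ext i
      · simp [Prod.fst_sum, Finset.sum_apply, Pi.single_apply]
      · simp [Prod.snd_sum]
    rw [h]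
    simp only [map_add, map_sum, map_smul, smul_eq_mul, φ, z]
  have hφ : ∀ j, 0 ≤ φ j := fun j => hfC0 _ ⟨0, by simp, fun i => by
    by_cases h : i = j <;> simp [h], by simp⟩
  have hz0 : z ≤ 0 := by
    have := hfC0 (0, -1) ⟨0, by simp, by simp, by simp⟩
    rw [hf] at this
    simpa using this
  have hU : ∀ ε : ℝ, 0 < ε → (1 - ε) * ∑ j, b j * φ j + (m + ε) * z < 0 := by
    intro ε hε
    have h := hfU (fun j => (1 - ε) * b j, m + ε)
      ⟨fun j => by nlinarith [hb j, mul_pos hε (hb j)], by simpa using hε⟩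
    rw [hf] at h
    simp only [mul_assoc, ← Finset.mul_sum] at h
    linarith
  have hbφ : 0 ≤ ∑ j, b j * φ j := Finset.sum_nonneg fun j _ => mul_nonneg (hb j).le (hφ j)
  have hz : z < 0 := by
    refine lt_of_le_of_ne hz0 fun h => ?_
    have := hU 1 one_pos
    rw [h] at this
    simp at this
  have hlim : ∑ j, b j * φ j + m * z ≤ 0 := by
    have ht : Filter.Tendsto (fun ε : ℝ => (1 - ε) * ∑ j, b j * φ j + (m + ε) * z)
        (nhdsWithin 0 (Set.Ioi 0)) (nhds ((1 - 0) * ∑ j, b j * φ j + (m + 0) * z)) :=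
      (Continuous.tendsto (by fun_prop) 0).mono_left nhdsWithin_le_nhds
    have := le_of_tendsto ht (Filter.eventually_of_mem self_mem_nhdsWithin fun ε hε => (hU ε hε).le)
    simpa using this
  -- Normalising the coefficient of the profit to `-1` turns `φ` into prices of the resources.
  refine ⟨fun j => φ j / -z, fun j => div_nonneg (hφ j) (by linarith), fun k => ?_, ?_⟩
  · have h := hfC0 (fun j => A j k, w k) ⟨Pi.single k 1, fun i => by
      by_cases h : i = k <;> simp [h], by simp [Pi.single_apply],
      by simp [Pi.single_apply]⟩
    rw [hf] at h
    simp only [← mul_div_assoc, ← Finset.sum_div]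
    rw [le_div_iff₀ (by linarith)]
    linarith
  · simp only [← mul_div_assoc, ← Finset.sum_div]
    rw [div_le_iff₀ (by linarith)]
    linarith

/-- Strong duality for packing programs: there are feasible solutions of the packing program and of
the dual covering program, of which the latter costs no more than the former earns. -/
theorem exists_packing_covering [Fintype J] (A : J → K → ℝ) (hA : ∀ j k, 0 ≤ A j k) (b : J → ℝ)
    (hb : ∀ j, 0 ≤ b j) (w : K → ℝ) (hcol : ∀ k, ∃ j, 0 < A j k) :
    ∃ (x : K → ℝ) (y : J → ℝ), (∀ k, 0 ≤ x k) ∧ (∀ j, ∑ k, A j k * x k ≤ b j) ∧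
      (∀ j, 0 ≤ y j) ∧ (∀ k, w k ≤ ∑ j, A j k * y j) ∧ ∑ j, b j * y j ≤ ∑ k, w k * x k := by
  classical
  obtain ⟨x, hx, hxb, hmax⟩ := exists_packing_max A hA b hb w hcol
  -- Exhausted resources get capacity one, while the variables needing them become unprofitable.
  let bad : K → Prop := fun k => ∃ j, b j = 0 ∧ 0 < A j k
  let b' : J → ℝ := fun j => if b j = 0 then 1 else b j
  let w' : K → ℝ := fun k => if bad k then 0 else w k
  have hb' : ∀ j, 0 < b' j := by
    intro j
    by_cases h : b j = 0
    · simp [b', h]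
    · simpa [b', h] using lt_of_le_of_ne (hb j) (Ne.symm h)
  obtain ⟨y, hy, hyw, hyb⟩ := exists_covering_of_forall_packing_le A b' hb' w' (∑ k, w k * x k) (by
    intro v hv hvb
    refine le_of_eq_of_le ?_ (hmax (fun k => if bad k then 0 else v k) (fun k => ?_) fun j => ?_)
    · refine Finset.sum_congr rfl fun k _ => ?_
      by_cases h : bad k <;> simp [w', h]
    · by_cases h : bad k <;> simp [h, hv k]
    · by_cases hj : b j = 0
      · rw [hj]
        refine Finset.sum_nonpos fun k _ => ?_
        by_cases h : bad k
        · simp [h]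
        · have : A j k = 0 := le_antisymm (not_lt.1 fun hpos => h ⟨j, hj, hpos⟩) (hA j k)
          simp [this]
      · have h1 : ∑ k, A j k * v k ≤ b j := by simpa [b', hj] using hvb j
        refine (Finset.sum_le_sum fun k _ => mul_le_mul_of_nonneg_left ?_ (hA j k)).trans h1
        by_cases h : bad k <;> simp [h, hv k])
  -- An exhausted resource is free in the objective, so its price may cover every profit by itself.
  let M : J → ℝ := fun j => ∑ k, |w k| / A j k
  have hM : ∀ j, 0 ≤ M j := fun j => Finset.sum_nonneg fun k _ => div_nonneg (abs_nonneg _) (hA j k)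
  let y' : J → ℝ := fun j => if b j = 0 then y j + M j else y j
  have hyy' : ∀ j, y j ≤ y' j := by
    intro j
    by_cases h : b j = 0 <;> simp [y', h, hM j]
  have hy' : ∀ j, 0 ≤ y' j := fun j => (hy j).trans (hyy' j)
  refine ⟨x, y', hx, hxb, hy', fun k => ?_, ?_⟩
  · by_cases h : bad k
    · obtain ⟨j, hj, hpos⟩ := h
      calc w k ≤ |w k| := le_abs_self _
        _ = A j k * (|w k| / A j k) := (mul_div_cancel₀ _ hpos.ne').symm
        _ ≤ A j k * y' j := by
            refine mul_le_mul_of_nonneg_left ?_ (hA j k)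
            have h1 : |w k| / A j k ≤ M j := Finset.single_le_sum
              (f := fun k => |w k| / A j k) (fun k _ => div_nonneg (abs_nonneg _) (hA j k))
              (Finset.mem_univ k)
            simp only [y', hj, if_true]
            linarith [hy j]
        _ ≤ ∑ j, A j k * y' j := Finset.single_le_sum (f := fun j => A j k * y' j)
            (fun j _ => mul_nonneg (hA j k) (hy' j)) (Finset.mem_univ j)
    · have h1 := hyw k
      simp only [w', h, if_false] at h1
      exact h1.trans (Finset.sum_le_sum fun j _ => mul_le_mul_of_nonneg_left (hyy' j) (hA j k))
  · refine (Finset.sum_le_sum fun j _ => ?_).trans hyb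
    by_cases h : b j = 0
    · simp [b', h, hy j]
    · simp [b', y', h]

end LinearProgramming

/-! ### The retraction onto the tight span -/

section Retraction

/-- The smallest nonnegative vector `r` with `w s t ≤ a s + r t` for all `s` and `t`. The value `none`
of the index contributes the lower bound `0`. -/
noncomputable def conjugate {S T : Type*} (w : S → T → ℝ) (a : S → ℝ) (t : T) : ℝ :=
  ⨆ i : Option S, i.elim 0 fun s => w s t - a s

theorem conjugate_le_iff {S T : Type*} [Finite S] {w : S → T → ℝ} {a : S → ℝ} {t : T} {r : ℝ} :
    conjugate w a t ≤ r ↔ 0 ≤ r ∧ ∀ s, w s t ≤ a s + r := by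
  rw [conjugate, ciSup_le_iff (Set.finite_range _).bddAbove, Option.forall]
  simp [add_comm]

theorem conjugate_nonneg {S T : Type*} [Finite S] (w : S → T → ℝ) (a : S → ℝ) (t : T) :
    0 ≤ conjugate w a t :=
  (conjugate_le_iff.1 le_rfl).1

theorem le_add_conjugate {S T : Type*} [Finite S] (w : S → T → ℝ) (a : S → ℝ) (s : S) (t : T) :
    w s t ≤ a s + conjugate w a t :=
  (conjugate_le_iff.1 le_rfl).2 s

theorem conjugate_sub_le {S T : Type*} [Finite S] (w : S → T → ℝ) {a b : S → ℝ} {δ : ℝ}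
    (hδ : 0 ≤ δ) (h : ∀ s, b s - a s ≤ δ) (t : T) :
    conjugate w a t - conjugate w b t ≤ δ := by
  rw [sub_le_iff_le_add, conjugate_le_iff]
  exact ⟨add_nonneg hδ (conjugate_nonneg w b t), fun s => by
    linarith [h s, le_add_conjugate w b s t]⟩

variable {S : Type*} {μ : S → S → ℝ}

/-- The retraction of `P_μ` onto `T_μ`: first the part on `S^r` and then the part on `S^c` is replaced
by the smallest vector that is feasible together with the other part. -/
noncomputable def retraction (μ : S → S → ℝ) (p : S ⊕ S → ℝ) : S ⊕ S → ℝ :=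
  Sum.elim (conjugate (fun t s => μ s t) (conjugate μ (p ∘ Sum.inl))) (conjugate μ (p ∘ Sum.inl))

theorem retraction_le [Finite S] {p : S ⊕ S → ℝ} (hp : p ∈ polyhedron μ) : retraction μ p ≤ p := by
  rintro (s | t)
  · change conjugate (fun t s => μ s t) (conjugate μ (p ∘ Sum.inl)) s ≤ _
    exact conjugate_le_iff.2 ⟨hp.2 (Sum.inl s), fun t =>
      (le_add_conjugate μ (p ∘ Sum.inl) s t).trans_eq (add_comm _ _)⟩
  · exact conjugate_le_iff.2 ⟨hp.2 _, fun s => hp.1 s t⟩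

theorem retraction_mem_tightSpan [Finite S] {p : S ⊕ S → ℝ} (hp : p ∈ polyhedron μ) :
    retraction μ p ∈ tightSpan μ := by
  refine ⟨⟨fun s t => ?_, ?_⟩, fun q hq hqp => ?_⟩
  · rw [add_comm]
    exact le_add_conjugate (fun t s => μ s t) (conjugate μ (p ∘ Sum.inl)) t s
  · rintro (s | t)
    · exact conjugate_nonneg (fun t s => μ s t) (conjugate μ (p ∘ Sum.inl)) s
    · exact conjugate_nonneg μ (p ∘ Sum.inl) t
  · rintro (s | t)
    · change conjugate (fun t s => μ s t) (conjugate μ (p ∘ Sum.inl)) s ≤ _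
      refine conjugate_le_iff.2 ⟨hq.2 (Sum.inl s), fun t => ?_⟩
      have h := hqp (Sum.inr t)
      simp only [retraction, Sum.elim_inr] at h
      linarith [hq.1 s t]
    · exact conjugate_le_iff.2 ⟨hq.2 _, fun s => by
        have h := (hqp (Sum.inl s)).trans (retraction_le hp (Sum.inl s))
        simp only [Function.comp_apply]
        linarith [hq.1 s t]⟩

theorem DInftyPlus_le_iff {X : Type*} [Fintype X] {p q : X → ℝ} {r : ℝ} (hr : 0 ≤ r) :
    DInftyPlus p q ≤ r ↔ ∀ i, q i - p i ≤ r := by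
  rw [DInftyPlus, pi_norm_le_iff_of_nonneg hr]
  refine forall_congr' fun i => ?_
  rw [Pi.posPart_apply, Real.norm_of_nonneg (posPart_nonneg _), posPart_def, sup_le_iff]
  simp [hr]

theorem DInfty_le_iff [Fintype S] {p q : S ⊕ S → ℝ} {r : ℝ} (hr : 0 ≤ r) :
    DInfty p q ≤ r ↔ (∀ s, q (Sum.inl s) - p (Sum.inl s) ≤ r) ∧
      ∀ s, p (Sum.inr s) - q (Sum.inr s) ≤ r := by
  rw [DInfty, max_le_iff, DInftyPlus_le_iff hr, DInftyPlus_le_iff hr]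
  rfl

theorem DInfty_nonneg [Fintype S] (p q : S ⊕ S → ℝ) : 0 ≤ DInfty p q :=
  (norm_nonneg _).trans (le_max_left _ _)

theorem DInfty_retraction_le [Fintype S] (μ : S → S → ℝ) (p q : S ⊕ S → ℝ) :
    DInfty (retraction μ p) (retraction μ q) ≤ DInfty p q := by
  have h0 := DInfty_nonneg p q
  have hc := ((DInfty_le_iff h0).1 le_rfl).1
  have hr := conjugate_sub_le μ (a := p ∘ Sum.inl) (b := q ∘ Sum.inl) h0 hc
  exact (DInfty_le_iff h0).2 ⟨conjugate_sub_le _ h0 hr, hr⟩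

/-- The only point of the tight span whose two coordinates at `s` are at most `0` is `μ_s`. -/
theorem eq_terminalPoint (hμ : IsDirectedMetric μ) {s : S} {p : S ⊕ S → ℝ} (hp : p ∈ tightSpan μ)
    (hc : p (Sum.inl s) ≤ 0) (hr : p (Sum.inr s) ≤ 0) : p = terminalPoint μ s := by
  have hle : terminalPoint μ s ≤ p := by
    rintro (t | t)
    · have := hp.1.1 t s
      simp only [terminalPoint, Sum.elim_inl]
      linarith
    · have := hp.1.1 s t
      simp only [terminalPoint, Sum.elim_inr]
      linarith
  refine le_antisymm (hp.2 ⟨fun a b => hμ.triangle a s b, ?_⟩ hle) hle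
  rintro (t | t) <;> exact hμ.nonneg _ _

end Retraction

namespace Network

variable {V E : Type*} {N : Network V E}

/-! ### Walks and distances -/

theorem IsWalk.append {u v x : V} {l l' : List E} (h : N.IsWalk u l v) (h' : N.IsWalk v l' x) :
    N.IsWalk u (l ++ l') x := by
  induction l generalizing u with
  | nil => obtain rfl : u = v := h; exact h'
  | cons e l ih => exact ⟨h.1, ih h.2⟩

theorem IsWalk.exists_suffix {u v x : V} {l : List E} (h : N.IsWalk u l v)
    (hl : (u :: l.map N.head).Nodup) (hx : x ∈ u :: l.map N.head) :
    ∃ l', l'.Sublist l ∧ N.IsWalk x l' v ∧ (x :: l'.map N.head).Nodup := by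
  induction l generalizing u with
  | nil =>
    obtain rfl : x = u := by simpa using hx
    exact ⟨[], List.Sublist.refl _, h, hl⟩
  | cons e l ih =>
    rcases List.mem_cons.1 hx with rfl | hx
    · exact ⟨e :: l, List.Sublist.refl _, h, hl⟩
    · obtain ⟨l', hs, hw, hn⟩ := ih h.2 (List.nodup_cons.1 hl).2 hx
      exact ⟨l', hs.cons e, hw, hn⟩

theorem IsWalk.exists_path {u v : V} {l : List E} (h : N.IsWalk u l v) :
    ∃ l', l'.Sublist l ∧ N.IsWalk u l' v ∧ (u :: l'.map N.head).Nodup := by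
  induction l generalizing u with
  | nil => exact ⟨[], List.Sublist.refl _, h, by simp⟩
  | cons e l ih =>
    obtain ⟨l', hs, hw, hn⟩ := ih h.2
    by_cases hu : u ∈ N.head e :: l'.map N.head
    · obtain ⟨l'', hs', hw', hn'⟩ := hw.exists_suffix hn hu
      exact ⟨l'', (hs'.trans hs).cons e, hw', hn'⟩
    · exact ⟨e :: l', hs.cons_cons e, ⟨h.1, hw⟩, List.nodup_cons.2 ⟨hu, hn⟩⟩

/-- A potential rises along a walk by no more than the length of the walk. -/
theorem IsWalk.sub_le_sum {g : V → ℝ} {w : E → ℝ} (hg : ∀ e, g (N.head e) - g (N.tail e) ≤ w e)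
    {u v : V} {l : List E} (h : N.IsWalk u l v) : g v - g u ≤ (l.map w).sum := by
  induction l generalizing u with
  | nil => obtain rfl : u = v := h; simp
  | cons e l ih =>
    obtain ⟨rfl, h⟩ := h
    rw [List.map_cons, List.sum_cons]
    linarith [ih h, hg e]

theorem sum_map_nonneg {w : E → ℝ} (hw : ∀ e, 0 ≤ w e) (l : List E) : 0 ≤ (l.map w).sum :=
  List.sum_nonneg fun a ha => by
    obtain ⟨e, _, rfl⟩ := List.mem_map.1 ha
    exact hw e

/-- The lengths of the walks from `u` to `v`, together with the bound `M` at which distances are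
truncated. -/
def lengths (N : Network V E) (w : E → ℝ) (M : ℝ) (u v : V) : Set ℝ :=
  insert M {r | ∃ l, N.IsWalk u l v ∧ r = (l.map w).sum}

/-- The distance from `u` to `v` for the edge lengths `w`, truncated at `M`. Truncation gives a finite
value also when `v` is not reachable from `u`. -/
noncomputable def walkDist (N : Network V E) (w : E → ℝ) (M : ℝ) (u v : V) : ℝ :=
  sInf (N.lengths w M u v)

section walkDist

variable {w : E → ℝ} {M : ℝ}

theorem le_walkDist {u v : V} {r : ℝ} (hrM : r ≤ M)
    (h : ∀ l, N.IsWalk u l v → r ≤ (l.map w).sum) : r ≤ N.walkDist w M u v := by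
  refine le_csInf (Set.insert_nonempty _ _) ?_
  rintro _ (rfl | ⟨l, hl, rfl⟩)
  · exact hrM
  · exact h l hl

variable (hw : ∀ e, 0 ≤ w e) (hM : 0 ≤ M)
include hw hM

theorem walkDist_nonneg (u v : V) : 0 ≤ N.walkDist w M u v :=
  le_walkDist hM fun l _ => sum_map_nonneg hw l

theorem bddBelow_lengths (u v : V) : BddBelow (N.lengths w M u v) := by
  refine ⟨0, ?_⟩
  rintro _ (rfl | ⟨l, _, rfl⟩)
  · exact hM
  · exact sum_map_nonneg hw l

theorem walkDist_le_bound (u v : V) : N.walkDist w M u v ≤ M :=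
  csInf_le (bddBelow_lengths hw hM u v) (Set.mem_insert _ _)

theorem walkDist_le_sum {u v : V} {l : List E} (h : N.IsWalk u l v) :
    N.walkDist w M u v ≤ (l.map w).sum :=
  csInf_le (bddBelow_lengths hw hM u v) (Set.mem_insert_of_mem _ ⟨l, h, rfl⟩)

theorem walkDist_self (u : V) : N.walkDist w M u u = 0 :=
  le_antisymm (walkDist_le_sum hw hM (l := []) rfl) (walkDist_nonneg hw hM u u)

theorem walkDist_edge (e : E) : N.walkDist w M (N.tail e) (N.head e) ≤ w e := by
  simpa using walkDist_le_sum hw hM (N := N) (l := [e]) ⟨rfl, rfl⟩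

theorem walkDist_triangle (u v x : V) :
    N.walkDist w M u x ≤ N.walkDist w M u v + N.walkDist w M v x := by
  have hux := walkDist_le_bound (N := N) hw hM u x
  have hvx := walkDist_nonneg (N := N) hw hM v x
  rw [← sub_le_iff_le_add]
  refine le_walkDist (by linarith) fun l hl => ?_
  rw [sub_le_comm]
  refine le_walkDist (by linarith [sum_map_nonneg hw l]) fun l' hl' => ?_
  have := walkDist_le_sum hw hM (hl.append hl')
  rw [List.map_append, List.sum_append] at this
  linarith

end walkDist

/-! ### Paths and weak duality -/

theorem SPath.nodup_edges (P : N.SPath) : P.edges.Nodup :=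
  List.Nodup.of_map _ (List.nodup_cons.1 P.nodup_vertices).2

theorem SPath.edges_ne_nil (P : N.SPath) : P.edges ≠ [] := fun h =>
  P.source_ne_target (by simpa [h, IsWalk] using P.isWalk)

instance [Finite V] [Finite E] : Finite N.SPath := by
  classical
  have := Fintype.ofFinite E
  refine Finite.of_injective
    (fun P : N.SPath => (P.source, P.target, (⟨P.edges, P.nodup_edges⟩ : {l : List E // l.Nodup}))) ?_
  rintro ⟨⟩ ⟨⟩ h
  simpa using h

open Classical in
theorem SPath.sum_edges [Fintype E] (P : N.SPath) (w : E → ℝ) :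
    (P.edges.map w).sum = ∑ e, if e ∈ P.edges then w e else 0 := by
  rw [← List.sum_toFinset w P.nodup_edges, ← Finset.sum_filter]
  exact Finset.sum_congr (by ext; simp) fun _ _ => rfl

/-- Weak duality: edge lengths that make every `S`-path at least as long as the value of its pair of
ends bound the value of every multiflow. -/
theorem val_le [Fintype E] {μ : N.S → N.S → ℝ} {w : E → ℝ} (hw : ∀ e, 0 ≤ w e)
    (h : ∀ P : N.SPath,
      μ ⟨P.source, P.source_mem⟩ ⟨P.target, P.target_mem⟩ ≤ (P.edges.map w).sum)
    (f : N.Multiflow) : N.val μ f ≤ ∑ e, (N.c e : ℝ) * w e := by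
  classical
  calc N.val μ f ≤ ∑ P ∈ f.paths, (∑ e, if e ∈ P.edges then w e else 0) * f.flow P :=
        Finset.sum_le_sum fun P hP => mul_le_mul_of_nonneg_right
          ((h P).trans_eq (P.sum_edges w)) (f.flow_nonneg P hP)
    _ = ∑ e, (∑ P ∈ f.paths with e ∈ P.edges, f.flow P) * w e := by
        simp only [Finset.sum_mul, Finset.sum_filter]
        rw [Finset.sum_comm]
        refine Finset.sum_congr rfl fun e _ => Finset.sum_congr rfl fun P _ => ?_
        split_ifs <;> ring
    _ ≤ ∑ e, (N.c e : ℝ) * w e :=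
        Finset.sum_le_sum fun e _ => mul_le_mul_of_nonneg_right
          (by convert f.capacity e) (hw e)

/-! ### Duality for multiflows -/

/-- Linear programming duality for multiflows: some multiflow has at least the value of some dual
feasible edge lengths. -/
theorem exists_multiflow_lengths [Finite V] [Fintype E] (N : Network V E) (μ : N.S → N.S → ℝ) :
    ∃ (f : N.Multiflow) (w : E → ℝ), (∀ e, 0 ≤ w e) ∧
      (∀ P : N.SPath,
        μ ⟨P.source, P.source_mem⟩ ⟨P.target, P.target_mem⟩ ≤ (P.edges.map w).sum) ∧
      ∑ e, (N.c e : ℝ) * w e ≤ N.val μ f := by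
  classical
  have := Fintype.ofFinite N.SPath
  obtain ⟨x, y, hx, hxc, hy, hyμ, hle⟩ := exists_packing_covering
    (fun (e : E) (P : N.SPath) => if e ∈ P.edges then (1 : ℝ) else 0)
    (fun e P => by split_ifs <;> norm_num) (fun e => (N.c e : ℝ)) (fun e => Nat.cast_nonneg _)
    (fun P => μ ⟨P.source, P.source_mem⟩ ⟨P.target, P.target_mem⟩) (fun P => by
      obtain ⟨e, he⟩ := List.exists_mem_of_ne_nil _ P.edges_ne_nil
      exact ⟨e, by simp [he]⟩)
  refine ⟨⟨Finset.univ, x, fun P _ => hx P, fun e => ?_⟩, y, hy, fun P => ?_, hle⟩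
  · refine le_of_eq_of_le ?_ (hxc e)
    rw [Finset.sum_filter]
    exact Finset.sum_congr rfl fun P _ => by split_ifs <;> simp
  · rw [P.sum_edges]
    refine (hyμ P).trans_eq (Finset.sum_congr rfl fun e _ => by split_ifs <;> simp)

/-- Dual feasible edge lengths dominate the `D_∞`-lengths of the edges under some map of the vertices
to the tight span that sends every terminal `s` to `μ_s`. -/
theorem exists_map_tightSpan (N : Network V E) {μ : N.S → N.S → ℝ} (hμ : IsDirectedMetric μ)
    {w : E → ℝ} (hw : ∀ e, 0 ≤ w e)
    (h : ∀ P : N.SPath,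
      μ ⟨P.source, P.source_mem⟩ ⟨P.target, P.target_mem⟩ ≤ (P.edges.map w).sum) :
    ∃ ρ : V → tightSpan μ, (∀ s : N.S, (ρ s : N.S ⊕ N.S → ℝ) = terminalPoint μ s) ∧
      ∀ e, DInfty (ρ (N.tail e) : N.S ⊕ N.S → ℝ) (ρ (N.head e)) ≤ w e := by
  -- Truncation at a bound for `μ` does not affect the inequality `μ ≤ d` on the terminals.
  let M : ℝ := ∑ s, ∑ t, μ s t
  have hμM : ∀ s t, μ s t ≤ M := fun s t =>
    (Finset.single_le_sum (f := fun t => μ s t) (fun t _ => hμ.nonneg s t)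
      (Finset.mem_univ t)).trans
      (Finset.single_le_sum (f := fun s => ∑ t, μ s t)
        (fun s _ => Finset.sum_nonneg fun t _ => hμ.nonneg s t) (Finset.mem_univ s))
  have hM : 0 ≤ M := Finset.sum_nonneg fun s _ => Finset.sum_nonneg fun t _ => hμ.nonneg s t
  let d := N.walkDist w M
  have hd : ∀ s t : N.S, μ s t ≤ d s t := by
    intro s t
    by_cases hst : s = t
    · rw [hst, hμ.self]
      exact walkDist_nonneg hw hM _ _
    · refine le_walkDist (hμM s t) fun l hl => ?_
      obtain ⟨l', hs, hwalk, hn⟩ := hl.exists_path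
      refine (h ⟨s, t, l', s.2, t.2, fun he => hst (Subtype.ext he), hwalk, hn⟩).trans ?_
      refine (hs.map w).sum_le_sum fun a ha => ?_
      obtain ⟨e, _, rfl⟩ := List.mem_map.1 ha
      exact hw e
  let p : V → N.S ⊕ N.S → ℝ := fun x => Sum.elim (fun s => d s x) (fun s => d x s)
  have hp : ∀ x, p x ∈ polyhedron μ := by
    refine fun x => ⟨fun s t => (hd s t).trans (walkDist_triangle hw hM _ _ _), ?_⟩
    rintro (s | s) <;> exact walkDist_nonneg hw hM _ _
  refine ⟨fun x => ⟨retraction μ (p x), retraction_mem_tightSpan (hp x)⟩, fun s => ?_, fun e => ?_⟩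
  · exact eq_terminalPoint hμ (retraction_mem_tightSpan (hp s))
      ((retraction_le (hp s) (Sum.inl s)).trans_eq (walkDist_self hw hM (s : V)))
      ((retraction_le (hp s) (Sum.inr s)).trans_eq (walkDist_self hw hM (s : V)))
  · refine (DInfty_retraction_le μ _ _).trans ((DInfty_le_iff (hw e)).2 ⟨fun s => ?_, fun s => ?_⟩)
    · have h1 := walkDist_triangle (N := N) hw hM s (N.tail e) (N.head e)
      have h2 := walkDist_edge (N := N) hw hM e
      simp only [p, d, Sum.elim_inl]
      linarith
    · have h1 := walkDist_triangle (N := N) hw hM (N.tail e) (N.head e) s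
      have h2 := walkDist_edge (N := N) hw hM e
      simp only [p, d, Sum.elim_inr]
      linarith

/-- The `D_∞`-lengths of the edges under a map that sends every terminal `s` to `μ_s` are dual
feasible. -/
theorem SPath.le_sum_DInfty {μ : N.S → N.S → ℝ} (hμ : IsDirectedMetric μ)
    {ρ : V → N.S ⊕ N.S → ℝ} (hρ : ∀ s : N.S, ρ s = terminalPoint μ s) (P : N.SPath) :
    μ ⟨P.source, P.source_mem⟩ ⟨P.target, P.target_mem⟩ ≤
      (P.edges.map fun e => DInfty (ρ (N.tail e)) (ρ (N.head e))).sum := by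
  have h := P.isWalk.sub_le_sum (g := fun x => ρ x (Sum.inl ⟨P.source, P.source_mem⟩)) fun e =>
    ((DInfty_le_iff (DInfty_nonneg (ρ (N.tail e)) (ρ (N.head e)))).1 le_rfl).1 _
  have hs := hρ ⟨P.source, P.source_mem⟩
  have ht := hρ ⟨P.target, P.target_mem⟩
  simp only at hs ht
  simpa [hs, ht, terminalPoint, hμ.self] using h

end Network

end DirectedTightSpan

theorem mainTheorem6 {V E : Type*} [Fintype V] [Fintype E]
    (N : DirectedTightSpan.Network V E) (μ : N.S → N.S → ℝ)
    (hμ : DirectedTightSpan.IsDirectedMetric μ) :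
    ∃ m : ℝ,
      IsGreatest {v : ℝ | ∃ f : N.Multiflow, v = N.val μ f} m ∧
      IsLeast {v : ℝ | ∃ ρ : V → DirectedTightSpan.tightSpan μ,
        (∀ s : N.S, (ρ s : N.S ⊕ N.S → ℝ) = DirectedTightSpan.terminalPoint μ s) ∧
        v = ∑ e : E, (N.c e : ℝ) *
          DirectedTightSpan.DInfty (ρ (N.tail e) : N.S ⊕ N.S → ℝ) (ρ (N.head e))} m := by
  obtain ⟨f, w, hw, hdual, hle⟩ := N.exists_multiflow_lengths μ
  obtain ⟨ρ, hρ, hρw⟩ := N.exists_map_tightSpan hμ hw hdual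
  have hweak : ∀ (ρ : V → DirectedTightSpan.tightSpan μ),
      (∀ s : N.S, (ρ s : N.S ⊕ N.S → ℝ) = DirectedTightSpan.terminalPoint μ s) →
      N.val μ f ≤ ∑ e : E, (N.c e : ℝ) *
        DirectedTightSpan.DInfty (ρ (N.tail e) : N.S ⊕ N.S → ℝ) (ρ (N.head e)) := fun ρ hρ =>
    DirectedTightSpan.Network.val_le (fun _ => DirectedTightSpan.DInfty_nonneg _ _)
      (fun P => P.le_sum_DInfty hμ (ρ := fun x => ρ x) hρ) f
  refine ⟨N.val μ f, ⟨⟨f, rfl⟩, ?_⟩, ⟨ρ, hρ, ?_⟩, ?_⟩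
  · rintro _ ⟨g, rfl⟩
    exact (DirectedTightSpan.Network.val_le hw hdual g).trans hle
  · refine le_antisymm (hweak ρ hρ) (le_trans (Finset.sum_le_sum fun e _ => ?_) hle)
    exact mul_le_mul_of_nonneg_left (hρw e) (Nat.cast_nonneg _)
  · rintro _ ⟨ρ', hρ', rfl⟩
    exact hweak ρ' hρ'
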